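/- For a positive integer $d$, let $K_d=\mathbb{Q}(\sqrt{d})$ and let $h_d$ denote the class number of $K_d$, i.e. the order of the ideal class group of its ring of integers. Let $p$ be a prime with $p\equiv 1\pmod 4$ and $h_p=1$, and let $m>1$ be a square-free integer not divisible by $p$. Then $h_{mp}\ge 2$. -/

import Mathlib

/-- The field `K_d = ℚ(√d)` for a natural number `d`, as a subfield of `ℝ`. -/
noncomputable abbrev RealQuadraticField (d : ℕ) : IntermediateField ℚ ℝ :=
  IntermediateField.adjoin ℚ {√(d : ℝ)}

theorem isIntegral_sqrt_natCast (d : ℕ) : IsIntegral ℚ √(d : ℝ) := by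
  have h : IsIntegral ℚ (√(d : ℝ) ^ 2) := by
    rw [Real.sq_sqrt (Nat.cast_nonneg d)]
    simpa using (isIntegral_algebraMap (R := ℚ) (A := ℝ) (x := (d : ℚ)))
  exact IsIntegral.of_pow two_pos h

instance instNumberFieldRealQuadraticField (d : ℕ) : NumberField (RealQuadraticField d) where
  to_charZero := inferInstance
  to_finiteDimensional := IntermediateField.adjoin.finiteDimensional (isIntegral_sqrt_natCast d)

/-- The class number `h_d` of `K_d = ℚ(√d)`: the order of the class group of its ring of
integers. -/
noncomputable def realQuadraticClassNumber (d : ℕ) : ℕ :=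
  NumberField.classNumber (RealQuadraticField d)

/-! Suppose the ring of integers `R` of `ℚ(√d)`, `d = mp`, is principal, and let `ε` be the
fundamental Pell solution. Modulo squares every unit of norm 1 is `±1` or `±ε`. If `e ∣ d`, then `e`
times its cofactor is `δ²` with coprime factors, so `e` is a unit of norm 1 times a square. It is
`±` a square only if `e` or `ed` is a square in `ℕ`; otherwise `e` lies in the class of `±ε`. Two
numbers in that class have product `±` a square, so the class has little room.

It contains `p` and any prime `q ∣ m`, which forces `m = q`. If `m ≡ 3 mod 4`, then 2 ramifies and
also lies in the class, which is impossible. Otherwise `d` is a sum of two squares, some unit has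
norm `-1`, and `ε` is `±` a square; then so is `p`, a contradiction. -/

/-- `R` behaves like the ring of integers of `ℚ(√d)`: `δ` is a square root of `d`, `σ` is the
conjugation, traces and norms are integers, and twice any element lies in `ℤ[δ]`. -/
structure IsQuadraticIntegerRing {R : Type*} [CommRing R] (d : ℕ) (σ : R →+* R) (δ : R) : Prop where
  sq_sqrt : δ ^ 2 = d
  conj_sqrt : σ δ = -δ
  decomp : ∀ z : R, ∃ t y n : ℤ, z + σ z = t ∧ z * σ z = n ∧ 2 * z = t + y * δ

/-- The element `x + y δ` attached to a solution of the Pell equation `x² - d y² = 1`. -/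
def pellToRing {R : Type*} [CommRing R] (d : ℕ) (δ : R) (h : δ ^ 2 = d) :
    Pell.Solution₁ (d : ℤ) →* R where
  toFun s := s.x + s.y * δ
  map_one' := by simp
  map_mul' s s' := by
    rw [Pell.Solution₁.x_mul, Pell.Solution₁.y_mul]
    push_cast
    linear_combination (-(s.y : R) * s'.y) * h

/-- With `x, y` made coprime, `y` divides `σ x`, and the quotient has norm `-1`. Thus if `-1` is a
norm from the fraction field, it is the norm of a unit. -/
theorem exists_norm_eq_neg_one {R : Type*} [CommRing R] [IsDomain R] [IsPrincipalIdealRing R]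
    (σ : R →+* R) (hσ : ∀ z, σ (σ z) = z) {x y : R} (hy : y ≠ 0)
    (h : x * σ x = -(y * σ y)) : ∃ η : R, η * σ η = -1 := by
  classical
  let _ : GCDMonoid R := IsBezout.toGCDDomain R
  have hσ0 : ∀ z, σ z = 0 → z = 0 := fun z hz => by rw [← hσ z, hz, map_zero]
  obtain ⟨x', y', hx', hy', hu⟩ := extract_gcd x y
  set g := gcd x y
  have hg : g ≠ 0 := fun h0 => hy (by rw [hy', h0, zero_mul])
  have hy0 : y' ≠ 0 := fun h0 => hy (by rw [hy', h0, mul_zero])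
  rw [gcd_isUnit_iff] at hu
  have h1 : x' * σ x' = -(y' * σ y') := by
    apply mul_left_cancel₀ (mul_ne_zero hg fun h0 => hg (hσ0 g h0))
    rw [hx', hy', map_mul, map_mul] at h
    linear_combination h
  obtain ⟨η, hη⟩ := hu.symm.dvd_of_dvd_mul_left (⟨-σ y', by rw [h1]; ring⟩ : y' ∣ x' * σ x')
  have h2 : σ y' = -(η * x') := by
    apply mul_left_cancel₀ hy0
    rw [hη] at h1
    linear_combination h1
  have h3 : x' = σ y' * σ η := by rw [← map_mul, ← hη, hσ]
  have hx0 : x' ≠ 0 := fun h0 => hy0 (hσ0 y' (by rw [h2, h0, mul_zero, neg_zero]))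
  refine ⟨η, mul_left_cancel₀ hx0 ?_⟩
  rw [h2] at h3
  linear_combination h3

/-! ### Units and rational integers modulo squares -/

namespace IsQuadraticIntegerRing

variable {R : Type*} [CommRing R] {d : ℕ} {σ : R →+* R} {δ : R}

theorem conj_conj (H : IsQuadraticIntegerRing d σ δ) (z : R) : σ (σ z) = z := by
  obtain ⟨t, y, n, h1, -, -⟩ := H.decomp z
  have h2 := congrArg σ h1
  rw [map_add, map_intCast] at h2
  linear_combination h2 - h1

theorem conj_pellToRing (H : IsQuadraticIntegerRing d σ δ) (s : Pell.Solution₁ (d : ℤ)) :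
    pellToRing d δ H.sq_sqrt s * σ (pellToRing d δ H.sq_sqrt s) = 1 := by
  have h := congrArg (Int.cast : ℤ → R) s.prop
  push_cast at h
  simp only [pellToRing, MonoidHom.coe_mk, OneHom.coe_mk, map_add, map_mul, map_intCast, H.conj_sqrt]
  linear_combination h - (s.y : R) ^ 2 * H.sq_sqrt

variable [CharZero R]

theorem eq_zero_of_add_mul_sqrt (H : IsQuadraticIntegerRing d σ δ) (hd : ¬IsSquare d) {a b : ℤ}
    (h : (a : R) + b * δ = 0) : b = 0 := by
  by_contra hb
  have h1 : ((a ^ 2 : ℤ) : R) = ((d * b ^ 2 : ℤ) : R) := by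
    push_cast
    linear_combination ((a : R) - b * δ) * h + (b : R) ^ 2 * H.sq_sqrt
  have h2 : a ^ 2 = d * b ^ 2 := Int.cast_injective h1
  have h3 : IsSquare ((d : ℤ) : ℚ) := by
    refine ⟨(a : ℚ) / b, ?_⟩
    have hb' : (b : ℚ) ≠ 0 := by exact_mod_cast hb
    field_simp
    exact_mod_cast h2.symm
  rw [Int.cast_natCast, Rat.isSquare_natCast_iff] at h3
  exact hd h3

theorem exists_pell_of_norm_eq_one (H : IsQuadraticIntegerRing d σ δ) {u : R}
    (hu : u * σ u = 1) {a b : ℤ} (h : u = a + b * δ) :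
    ∃ s, pellToRing d δ H.sq_sqrt s = u := by
  have h1 : a ^ 2 - (d : ℤ) * b ^ 2 = 1 := by
    apply Int.cast_injective (α := R)
    rw [h, map_add, map_mul, map_intCast, map_intCast, H.conj_sqrt] at hu
    push_cast
    linear_combination hu + (b : R) ^ 2 * H.sq_sqrt
  exact ⟨Pell.Solution₁.mk a b h1, by simp [pellToRing, h]⟩

/-- Taking norms gives `N(π)² N(v) = e² > 0`, which excludes `N(v) = -1`. -/
theorem norm_unit_eq_one (H : IsQuadraticIntegerRing d σ δ) {e : ℕ} (he : e ≠ 0) {π : R} {v : Rˣ}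
    (h : π ^ 2 * v = e) : (v : R) * σ v = 1 := by
  obtain ⟨-, -, n, -, hn, -⟩ := H.decomp π
  obtain ⟨-, -, k, -, hk, -⟩ := H.decomp v
  obtain ⟨-, -, l, -, hl, -⟩ := H.decomp (v⁻¹ : Rˣ)
  have h1 : k * l = 1 := by
    apply Int.cast_injective (α := R)
    have := v.mul_inv
    have h2 : σ v * σ (v⁻¹ : Rˣ) = 1 := by rw [← map_mul, this, map_one]
    push_cast
    rw [← hk, ← hl]
    linear_combination this + (v : R) * (v⁻¹ : Rˣ) * h2
  have h2 : n ^ 2 * k = (e : ℤ) ^ 2 := by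
    apply Int.cast_injective (α := R)
    have h3 := congrArg σ h
    rw [map_mul, map_pow, map_natCast] at h3
    push_cast
    rw [← hn, ← hk, sq (e : R)]
    nth_rewrite 1 [← h]
    rw [← h3]
    ring
  have hk0 : 0 < k := by
    have : 0 < n ^ 2 * k := by rw [h2]; positivity
    exact pos_of_mul_pos_right this (sq_nonneg n)
  have : k = 1 := by
    rcases Int.eq_one_or_neg_one_of_mul_eq_one h1 with h | h <;> omega
  rw [hk, this, Int.cast_one]

/-- Write `2z = t + yδ`. The `δ`-part of `4z²` must vanish, so `t = 0` or `y = 0`; the rest, `t² +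
dy²`, is nonnegative, which excludes the minus sign. -/
theorem isSquare_or_of_sq (H : IsQuadraticIntegerRing d σ δ) (hd : ¬IsSquare d) {e : ℕ} (he : e ≠ 0)
    {z : R} (h : (e : R) = z ^ 2 ∨ (e : R) = -z ^ 2) :
    (e : R) = z ^ 2 ∧ (IsSquare e ∨ IsSquare (e * d)) := by
  obtain ⟨t, y, n, -, -, h3⟩ := H.decomp z
  have hd0 : 0 < d := Nat.pos_of_ne_zero fun h0 => hd (h0 ▸ IsSquare.zero)
  have hz : 4 * z ^ 2 = ((t ^ 2 + d * y ^ 2 : ℤ) : R) + ((2 * t * y : ℤ) : R) * δ := by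
    push_cast
    linear_combination (2 * z + t + y * δ) * h3 + (y : R) ^ 2 * H.sq_sqrt
  have key : (e : R) = z ^ 2 ∧ t * y = 0 ∧ 4 * (e : ℤ) = t ^ 2 + d * y ^ 2 := by
    rcases h with h | h
    · have h4 : ((t ^ 2 + d * y ^ 2 - 4 * e : ℤ) : R) + ((2 * t * y : ℤ) : R) * δ = 0 := by
        push_cast at hz ⊢
        linear_combination -hz - 4 * h
      have h5 := H.eq_zero_of_add_mul_sqrt hd h4
      have h6 := h4
      rw [h5, Int.cast_zero, zero_mul, add_zero, Int.cast_eq_zero] at h6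
      exact ⟨h, by linarith, by linarith⟩
    · have h4 : ((t ^ 2 + d * y ^ 2 + 4 * e : ℤ) : R) + ((2 * t * y : ℤ) : R) * δ = 0 := by
        push_cast at hz ⊢
        linear_combination -hz + 4 * h
      have h5 := H.eq_zero_of_add_mul_sqrt hd h4
      have h6 := h4
      rw [h5, Int.cast_zero, zero_mul, add_zero, Int.cast_eq_zero] at h6
      have : 0 < (e : ℤ) := by positivity
      have : 0 ≤ t ^ 2 + d * y ^ 2 := by positivity
      omega
  obtain ⟨h4, hty, h5⟩ := key
  refine ⟨h4, ?_⟩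
  rcases mul_eq_zero.1 hty with h0 | h0
  · right
    rw [← Rat.isSquare_natCast_iff]
    refine ⟨(d : ℚ) * y / 2, ?_⟩
    have h6 : 4 * (e : ℚ) = d * y ^ 2 := by
      rw [h0] at h5
      exact_mod_cast (by linarith : 4 * (e : ℤ) = d * y ^ 2)
    push_cast
    linear_combination (d : ℚ) / 4 * h6
  · left
    rw [← Rat.isSquare_natCast_iff]
    refine ⟨(t : ℚ) / 2, ?_⟩
    have h6 : 4 * (e : ℚ) = t ^ 2 := by
      rw [h0] at h5
      exact_mod_cast (by linarith : 4 * (e : ℤ) = t ^ 2)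
    linear_combination h6 / 4

variable [IsDomain R]

/-- Cubing removes the denominator 2 that units may have when `d ≡ 1 mod 4`. Being odd, the exponent
3 does not change the class modulo squares. -/
theorem exists_pell_eq_cube (H : IsQuadraticIntegerRing d σ δ) (hsq : Squarefree d) {u : R}
    (hu : u * σ u = 1) : ∃ s, pellToRing d δ H.sq_sqrt s = u ^ 3 := by
  obtain ⟨t, y, n, h1, -, h3⟩ := H.decomp u
  have hu3 : u ^ 3 * σ (u ^ 3) = 1 := by rw [map_pow, ← mul_pow, hu, one_pow]
  have hu2 : u ^ 2 = t * u - 1 := by linear_combination u * h1 - hu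
  rcases Int.even_or_odd' t with ⟨c, hc | hc⟩
  · have h4 : t ^ 2 - d * y ^ 2 = 4 := by
      apply Int.cast_injective (α := R)
      push_cast
      linear_combination -4 * hu2 + (2 * u - t + y * δ) * h3 + (y : R) ^ 2 * H.sq_sqrt
    have hy : Even y := by
      by_contra hy
      rw [Int.not_even_iff_odd] at hy
      have h5 : (4 : ℤ) ∣ d * y ^ 2 := ⟨c ^ 2 - 1, by rw [hc] at h4; linarith⟩
      have h6 : IsCoprime (4 : ℤ) (y ^ 2) := by
        have : IsCoprime (2 : ℤ) y := (Int.isCoprime_two_left).2 hy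
        simpa using this.pow (m := 2) (n := 2)
      have h7 : (4 : ℤ) ∣ d := h6.dvd_of_dvd_mul_right h5
      have h8 : 2 * 2 ∣ d := by exact_mod_cast h7
      exact absurd (hsq 2 h8) (by decide)
    obtain ⟨b, hb⟩ := hy
    obtain ⟨s, hs⟩ := H.exists_pell_of_norm_eq_one hu (a := c) (b := b) (by
      apply mul_left_cancel₀ (two_ne_zero (α := R))
      rw [h3, hc, hb]
      push_cast
      ring)
    exact ⟨s ^ 3, by rw [map_pow, hs]⟩
  -- For `t = 2c + 1`, `u³ = (t² - 1)u - t` and `t² - 1 = 4c(c + 1)` absorbs the denominator of `u`.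
  · refine H.exists_pell_of_norm_eq_one hu3 (a := 2 * (c * (c + 1)) * t - t)
      (b := 2 * (c * (c + 1)) * y) ?_
    have ht : (t : R) = 2 * c + 1 := by rw [hc]; push_cast; ring
    have h5 : u ^ 3 = (t ^ 2 - 1) * u - t := by linear_combination (u + t) * hu2
    rw [h5]
    push_cast
    linear_combination (2 * (c : R) * (c + 1)) * h3 + (t + 2 * c + 1) * u * ht

theorem pow_three_eq (H : IsQuadraticIntegerRing d σ δ) (hsq : Squarefree d)
    {a : Pell.Solution₁ (d : ℤ)} (ha : Pell.IsFundamental a) {u : Rˣ} (hu : (u : R) * σ u = 1) :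
    ∃ n : ℤ, u ^ 3 = (pellToRing d δ H.sq_sqrt).toHomUnits a ^ n ∨
      u ^ 3 = -(pellToRing d δ H.sq_sqrt).toHomUnits a ^ n := by
  obtain ⟨s, hs⟩ := H.exists_pell_eq_cube hsq hu
  obtain ⟨n, rfl | rfl⟩ := ha.eq_zpow_or_neg_zpow s
  · refine ⟨n, Or.inl (Units.ext ?_)⟩
    rw [← map_zpow, MonoidHom.coe_toHomUnits, hs, Units.val_pow_eq_pow_val]
  · refine ⟨n, Or.inr (Units.ext ?_)⟩
    rw [← map_zpow, Units.val_neg, MonoidHom.coe_toHomUnits, Units.val_pow_eq_pow_val, ← hs]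
    simp only [pellToRing, MonoidHom.coe_mk, OneHom.coe_mk, Pell.Solution₁.x_neg,
      Pell.Solution₁.y_neg]
    push_cast
    ring

theorem isSquare_or_of_isCoprime (H : IsQuadraticIntegerRing d σ δ) [IsPrincipalIdealRing R]
    (hd : ¬IsSquare d) (hsq : Squarefree d) {a : Pell.Solution₁ (d : ℤ)}
    (ha : Pell.IsFundamental a) {e : ℕ} (he : e ≠ 0) {f x : R} (hef : IsCoprime (e : R) f)
    (hx : e * f = x ^ 2) : (IsSquare e ∨ IsSquare (e * d)) ∨
      ∃ z : R, (e : R) = pellToRing d δ H.sq_sqrt a * z ^ 2 ∨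
        (e : R) = -(pellToRing d δ H.sq_sqrt a * z ^ 2) := by
  obtain ⟨π, v, hv⟩ := exists_associated_pow_of_mul_eq_pow' hef hx
  obtain ⟨n, hn⟩ := H.pow_three_eq hsq ha (H.norm_unit_eq_one he hv)
  set U := (pellToRing d δ H.sq_sqrt).toHomUnits a with hU
  have hUa : pellToRing d δ H.sq_sqrt a = U := rfl
  rw [hUa, ← hv]
  -- `v` and `v³` agree modulo squares, so only the parity of `n` matters.
  have h1 : v = v ^ 3 * (v⁻¹) ^ 2 := by rw [inv_pow, pow_succ' v 2, mul_inv_cancel_right]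
  obtain ⟨j, rfl | rfl⟩ := Int.even_or_odd' n
  · left
    refine (H.isSquare_or_of_sq hd he (z := π * (U ^ j * v⁻¹ : Rˣ)) ?_).2
    rw [← hv]
    have h2 : U ^ (2 * j) = (U ^ j) ^ 2 := by rw [← zpow_natCast, ← zpow_mul, mul_comm]; rfl
    rw [h2] at hn
    rcases hn with hn | hn
    · left
      have h3 : (v : R) = ((U ^ j) ^ 2 * v⁻¹ ^ 2 : Rˣ) := by rw [← hn, ← h1]
      push_cast at h3 ⊢
      linear_combination π ^ 2 * h3
    · right
      have h3 : (v : R) = (-(U ^ j) ^ 2 * v⁻¹ ^ 2 : Rˣ) := by rw [← hn, ← h1]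
      push_cast at h3 ⊢
      linear_combination π ^ 2 * h3
  · right
    refine ⟨π * (U ^ j * v⁻¹ : Rˣ), ?_⟩
    have h2 : U ^ (2 * j + 1) = U * (U ^ j) ^ 2 := by
      rw [zpow_add_one, mul_comm U, ← zpow_natCast, ← zpow_mul, mul_comm j]; rfl
    rw [h2] at hn
    rcases hn with hn | hn
    · left
      have h3 : (v : R) = (U * (U ^ j) ^ 2 * v⁻¹ ^ 2 : Rˣ) := by rw [← hn, ← h1]
      push_cast at h3 ⊢
      linear_combination π ^ 2 * h3
    · right
      have h3 : (v : R) = (-(U * (U ^ j) ^ 2) * v⁻¹ ^ 2 : Rˣ) := by rw [← hn, ← h1]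
      push_cast at h3 ⊢
      linear_combination π ^ 2 * h3

theorem exists_pell_eq_sq (H : IsQuadraticIntegerRing d σ δ) [IsPrincipalIdealRing R]
    (hd : ¬IsSquare d) (hsq : Squarefree d) {a : Pell.Solution₁ (d : ℤ)}
    (ha : Pell.IsFundamental a) {b c : ℕ} (hbc : d = b ^ 2 + c ^ 2) :
    ∃ z : R, pellToRing d δ H.sq_sqrt a = z ^ 2 ∨ pellToRing d δ H.sq_sqrt a = -z ^ 2 := by
  have hc : c ≠ 0 := by
    rintro rfl
    exact hd ⟨b, by rw [hbc]; ring⟩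
  have hbc' : (d : R) = b ^ 2 + c ^ 2 := by rw [hbc]; push_cast; rfl
  -- `(b + δ)(b - δ) = b² - d = -c²`.
  obtain ⟨η, hη⟩ := exists_norm_eq_neg_one σ H.conj_conj (x := b + δ) (y := (c : R))
    (by exact_mod_cast hc) (by
      rw [map_add, map_natCast, map_natCast, H.conj_sqrt]
      linear_combination -hbc' - H.sq_sqrt)
  let E : Rˣ := Units.mkOfMulEqOne η (-σ η) (by rw [mul_neg, hη, neg_neg])
  have hE : (E : R) * σ E = -1 := hη
  have hE2 : ((E ^ 2 : Rˣ) : R) * σ (E ^ 2 : Rˣ) = 1 := by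
    rw [Units.val_pow_eq_pow_val, map_pow, ← mul_pow, hE]
    ring
  obtain ⟨n, hn⟩ := H.pow_three_eq hsq ha hE2
  set U := (pellToRing d δ H.sq_sqrt).toHomUnits a with hU
  have hUa : pellToRing d δ H.sq_sqrt a = U := rfl
  have h6 : (E ^ 2) ^ 3 = (E ^ 3) ^ 2 := by rw [← pow_mul, ← pow_mul]
  rw [h6] at hn
  obtain ⟨j, rfl | rfl⟩ := Int.even_or_odd' n
  -- For even `n`, `E³ = ±U^j`, but the norms are `-1` and `1`.
  · exfalso
    have h2 : U ^ (2 * j) = (U ^ j) ^ 2 := by rw [← zpow_natCast, ← zpow_mul, mul_comm]; rfl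
    rw [h2] at hn
    have h3 : (1 : R) = ((E ^ 3 * (U ^ j)⁻¹ : Rˣ) : R) ^ 2 := by
      have := (H.isSquare_or_of_sq hd one_ne_zero (z := ((E ^ 3 * (U ^ j)⁻¹ : Rˣ) : R)) ?_).1
      · rwa [Nat.cast_one] at this
      · rw [← Units.val_pow_eq_pow_val, mul_pow, Nat.cast_one]
        rcases hn with hn | hn
        · left; rw [hn, inv_pow, mul_inv_cancel, Units.val_one]
        · right; rw [hn, inv_pow, neg_mul, mul_inv_cancel, Units.val_neg, neg_neg, Units.val_one]
    have h4 : (E : R) ^ 3 = (U ^ j : Rˣ) ∨ (E : R) ^ 3 = -(U ^ j : Rˣ) := by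
      rw [← sq_eq_sq_iff_eq_or_eq_neg]
      have : ((U ^ j : Rˣ) : R) * ((U ^ j)⁻¹ : Rˣ) = 1 := Units.mul_inv _
      rw [Units.val_mul, Units.val_pow_eq_pow_val] at h3
      linear_combination (-((U ^ j : Rˣ) : R) ^ 2) * h3 -
        (((U ^ j : Rˣ) : R) * ((U ^ j)⁻¹ : Rˣ) + 1) * (E : R) ^ 6 * this
    have h5 : ((U ^ j : Rˣ) : R) * σ (U ^ j : Rˣ) = 1 := by
      rw [hU, ← map_zpow]
      exact H.conj_pellToRing (a ^ j)
    have h7 : (E : R) ^ 3 * σ ((E : R) ^ 3) = -1 := by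
      rw [map_pow, ← mul_pow, hE]
      ring
    have h8 : (1 : R) = -1 := by
      rcases h4 with h4 | h4 <;> rw [h4] at h7
      · exact h5.symm.trans h7
      · rw [map_neg, neg_mul_neg] at h7
        exact h5.symm.trans h7
    have : (2 : R) = 0 := by linear_combination h8
    exact two_ne_zero this
  · have h2 : U ^ (2 * j + 1) = U * (U ^ j) ^ 2 := by
      rw [zpow_add_one, mul_comm U, ← zpow_natCast, ← zpow_mul, mul_comm j]; rfl
    refine ⟨(E ^ 3 * (U ^ j)⁻¹ : Rˣ), ?_⟩
    rw [← Units.val_pow_eq_pow_val, mul_pow, hUa]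
    rcases hn with hn | hn
    · left
      rw [hn, h2, inv_pow, mul_inv_cancel_right]
    · right
      rw [hn, h2, inv_pow, neg_mul, mul_inv_cancel_right, Units.val_neg, neg_neg]

end IsQuadraticIntegerRing

/-! ### Contradiction from principality -/

theorem Nat.Prime.not_isSquare_mul {p k : ℕ} (hp : p.Prime) (hk : ¬p ∣ k) : ¬IsSquare (p * k) := by
  rintro ⟨r, hr⟩
  have h1 : p ∣ r := (hp.dvd_mul.1 (hr ▸ dvd_mul_right p k)).elim id id
  obtain ⟨s, rfl⟩ := h1
  exact hk ⟨s * s, Nat.eq_of_mul_eq_mul_left hp.pos (by rw [hr]; ring)⟩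

theorem IsSquare.of_mul_self_mul {n k : ℕ} (h : IsSquare (n * n * k)) (hn : n ≠ 0) :
    IsSquare k := by
  obtain ⟨r, hr⟩ := h
  obtain ⟨s, rfl⟩ : n ∣ r := by
    rw [← Nat.pow_dvd_pow_iff two_ne_zero, _root_.sq n, _root_.sq r, ← hr]
    exact dvd_mul_right _ _
  exact ⟨s, Nat.eq_of_mul_eq_mul_left (Nat.pos_of_ne_zero (mul_ne_zero hn hn)) (by rw [hr]; ring)⟩

theorem Squarefree.eq_one_of_isSquare {n : ℕ} (h : Squarefree n) (hn : IsSquare n) : n = 1 := by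
  obtain ⟨r, rfl⟩ := hn
  rw [Nat.isUnit_iff.1 (h r dvd_rfl)]

theorem not_isPrincipalIdealRing_of_prime_mul {R : Type*} [CommRing R] [IsDomain R] [CharZero R]
    {p m : ℕ} {σ : R →+* R} {δ : R} (H : IsQuadraticIntegerRing (m * p) σ δ) (hp : p.Prime)
    (hp4 : p % 4 = 1) (hm : 1 < m) (hmsq : Squarefree m) (hpm : ¬p ∣ m) :
    ¬IsPrincipalIdealRing R := by
  intro hR
  have hp1 := hp.one_lt
  have hcop : m.Coprime p := ((Nat.Prime.coprime_iff_not_dvd hp).2 hpm).symm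
  have hsq : Squarefree (m * p) := (Nat.squarefree_mul hcop).2 ⟨hmsq, hp.squarefree⟩
  have hd : ¬IsSquare (m * p) := by rw [mul_comm]; exact hp.not_isSquare_mul hpm
  obtain ⟨a, ha⟩ := Pell.IsFundamental.exists_of_not_isSquare (d := ((m * p : ℕ) : ℤ))
    (by have : 0 < m * p := by positivity
        exact_mod_cast this)
    (by rwa [← Rat.isSquare_intCast_iff, Int.cast_natCast, Rat.isSquare_natCast_iff])
  have key : ∀ e f : ℕ, e * f = m * p → (IsSquare e ∨ IsSquare (e * (m * p))) ∨
      ∃ z : R, (e : R) = pellToRing (m * p) δ H.sq_sqrt a * z ^ 2 ∨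
        (e : R) = -(pellToRing (m * p) δ H.sq_sqrt a * z ^ 2) := by
    intro e f hef
    have he : e ≠ 0 := by rintro rfl; rw [zero_mul] at hef; exact hsq.ne_zero hef.symm
    refine H.isSquare_or_of_isCoprime hd hsq ha he (f := (f : R)) (x := δ) ?_ ?_
    · have h1 : e.Coprime f := Nat.coprime_of_squarefree_mul (hef ▸ hsq)
      simpa using (Nat.isCoprime_iff_coprime.2 h1).map (Int.castRingHom R)
    · rw [H.sq_sqrt, ← hef, Nat.cast_mul]
  have prod : ∀ e f : ℕ, e ≠ 0 → f ≠ 0 →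
      (∃ z : R, (e : R) = pellToRing (m * p) δ H.sq_sqrt a * z ^ 2 ∨
        (e : R) = -(pellToRing (m * p) δ H.sq_sqrt a * z ^ 2)) →
      (∃ z : R, (f : R) = pellToRing (m * p) δ H.sq_sqrt a * z ^ 2 ∨
        (f : R) = -(pellToRing (m * p) δ H.sq_sqrt a * z ^ 2)) →
      IsSquare (e * f) ∨ IsSquare (e * f * (m * p)) := by
    rintro e f he hf ⟨z, hz⟩ ⟨w, hw⟩
    refine (H.isSquare_or_of_sq hd (mul_ne_zero he hf)
      (z := pellToRing (m * p) δ H.sq_sqrt a * z * w) ?_).2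
    rw [Nat.cast_mul]
    rcases hz with hz | hz <;> rcases hw with hw | hw <;> rw [hz, hw]
    · left; ring
    · right; ring
    · right; ring
    · left; ring
  have hps : ¬(IsSquare p ∨ IsSquare (p * (m * p))) := by
    rintro (h | h)
    · exact hp.prime.irreducible.not_isSquare h
    · rw [show p * (m * p) = p * p * m by ring] at h
      exact hm.ne' (hmsq.eq_one_of_isSquare (h.of_mul_self_mul hp.ne_zero))
  have hpA := (key p m (mul_comm _ _)).resolve_left hps
  obtain ⟨q, hq, hqm⟩ := Nat.exists_prime_and_dvd hm.ne'
  obtain ⟨k, hk⟩ := hqm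
  have hpq : ¬p ∣ q := fun h => hpm (hk ▸ h.mul_right k)
  have hqA := (key q (k * p) (by rw [hk]; ring)).resolve_left (by
    rintro (h | h)
    · exact hq.prime.irreducible.not_isSquare h
    · rw [show q * (m * p) = p * (q * m) by ring] at h
      exact hp.not_isSquare_mul (fun h' => (hp.dvd_mul.1 h').elim hpq hpm) h)
  -- With `m = qk`, `pq · mp = (pq)² k`, so the squarefree `k` is a square, hence 1.
  have hmq : m = q := by
    rcases prod p q hp.ne_zero hq.ne_zero hpA hqA with h | h
    · exact absurd h (hp.not_isSquare_mul hpq)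
    · have hk1 : IsSquare k := by
        rw [hk, show p * q * (q * k * p) = p * q * (p * q) * k by ring] at h
        exact h.of_mul_self_mul (mul_ne_zero hp.ne_zero hq.ne_zero)
      rw [hk, Squarefree.eq_one_of_isSquare (hmsq.squarefree_of_dvd ⟨q, by rw [hk, mul_comm]⟩) hk1,
        mul_one]
  subst hmq
  by_cases hm3 : m % 4 = 3
  · have h2 : (IsSquare 2 ∨ IsSquare (2 * (m * p))) ∨
      ∃ z : R, ((2 : ℕ) : R) = pellToRing (m * p) δ H.sq_sqrt a * z ^ 2 ∨
        ((2 : ℕ) : R) = -(pellToRing (m * p) δ H.sq_sqrt a * z ^ 2) := by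
      have h4 : (m * p) % 4 = 3 := by rw [Nat.mul_mod, hm3, hp4]
      obtain ⟨c, hc⟩ : ∃ c, m * p = 4 * c + 3 := ⟨m * p / 4, by omega⟩
      have hδ : δ ^ 2 = 4 * c + 3 := by rw [H.sq_sqrt, hc]; push_cast; ring
      -- `(1 + δ)² = 2(2(c + 1) + δ)` exhibits the ramification of 2.
      refine H.isSquare_or_of_isCoprime hd hsq ha two_ne_zero (f := 2 * (c + 1) + δ)
        (x := 1 + δ) ?_ ?_
      · refine ⟨-(2 * (c : R) + 1) - (c + 1) * δ, δ, ?_⟩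
        push_cast
        linear_combination hδ
      · push_cast
        linear_combination -hδ
    have hp2 : ¬p ∣ 2 := fun h => by
      have := Nat.le_of_dvd two_pos h
      omega
    have hm2 : ¬m ∣ 2 := fun h => by
      have := Nat.le_of_dvd two_pos h
      omega
    rcases h2 with (h2 | h2) | h2
    · exact Nat.prime_two.prime.irreducible.not_isSquare h2
    · rw [show 2 * (m * p) = p * (2 * m) by ring] at h2
      exact hp.not_isSquare_mul (fun h' => (hp.dvd_mul.1 h').elim hp2 hpm) h2
    · rcases prod p 2 hp.ne_zero two_ne_zero hpA h2 with h | h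
      · exact hp.not_isSquare_mul hp2 h
      · rw [show p * 2 * (m * p) = p * p * (m * 2) by ring] at h
        exact hq.not_isSquare_mul hm2 (h.of_mul_self_mul hp.ne_zero)
  -- Here `m = 2` or `m ≡ 1 mod 4`, so `mp` is a sum of two squares.
  · have := Fact.mk hp
    have := Fact.mk hq
    obtain ⟨x, y, hxy⟩ := Nat.Prime.sq_add_sq hm3
    obtain ⟨u, v, huv⟩ := Nat.Prime.sq_add_sq (p := p) (by omega)
    obtain ⟨b, c, hbc⟩ := Nat.sq_add_sq_mul hxy.symm huv.symm
    obtain ⟨w, hw⟩ := H.exists_pell_eq_sq hd hsq ha hbc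
    obtain ⟨z, hz⟩ := hpA
    refine hps (H.isSquare_or_of_sq hd hp.ne_zero (z := w * z) ?_).2
    rcases hz with hz | hz <;> rcases hw with hw | hw <;> rw [hz, hw]
    · left; ring
    · right; ring
    · right; ring
    · left; ring


/-! ### The ring of integers of `ℚ(√d)` -/

open NumberField

theorem exists_intCast_eq_of_mul_sq {d : ℕ} (hd : Squarefree d) {y : ℚ} {k : ℤ}
    (h : d * y ^ 2 = k) : ∃ n : ℤ, y = n := by
  have hd0 : (d : ℚ) ≠ 0 := by exact_mod_cast hd.ne_zero
  have h1 : IsIntegral ℤ ((d : ℚ) * y) := by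
    refine IsIntegral.of_pow two_pos ?_
    rw [show ((d : ℚ) * y) ^ 2 = ((d * k : ℤ) : ℚ) by push_cast; rw [← h]; ring]
    exact isIntegral_algebraMap (R := ℤ)
  obtain ⟨w, hw⟩ := IsIntegrallyClosed.isIntegral_iff.1 h1
  have hw' : (w : ℚ) = d * y := hw
  have h2 : (d : ℤ) ∣ w ^ 2 := by
    refine ⟨k, ?_⟩
    have : (w : ℚ) ^ 2 = d * k := by rw [hw', ← h]; ring
    exact_mod_cast this
  have h3 : (d : ℤ) ∣ w :=
    (Int.squarefree_natCast.2 hd).isRadical 2 w h2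
  obtain ⟨n, rfl⟩ := h3
  refine ⟨n, mul_left_cancel₀ hd0 ?_⟩
  rw [← hw']
  push_cast
  rfl

theorem RealQuadraticField.exists_rat_add_mul_sqrt {d : ℕ} (z : RealQuadraticField d) :
    ∃ r s : ℚ, (z : ℝ) = r + s * √(d : ℝ) := by
  obtain ⟨z, hz⟩ := z
  change ∃ r s : ℚ, z = r + s * √(d : ℝ)
  have h0 : √(d : ℝ) ^ 2 = d := Real.sq_sqrt (Nat.cast_nonneg d)
  rw [← IntermediateField.mem_toSubalgebra,
    IntermediateField.adjoin_simple_toSubalgebra_of_isAlgebraic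
      (isIntegral_sqrt_natCast d).isAlgebraic] at hz
  induction hz using Algebra.adjoin_induction with
  | mem x hx => exact ⟨0, 1, by rw [Set.mem_singleton_iff.1 hx]; simp⟩
  | algebraMap r => exact ⟨r, 0, by simp⟩
  | add x y _ _ hx hy =>
    obtain ⟨r, s, h⟩ := hx
    obtain ⟨r', s', h'⟩ := hy
    exact ⟨r + r', s + s', by rw [h, h']; push_cast; ring⟩
  | mul x y _ _ hx hy =>
    obtain ⟨r, s, h⟩ := hx
    obtain ⟨r', s', h'⟩ := hy
    refine ⟨r * r' + s * s' * d, r * s' + s * r', ?_⟩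
    rw [h, h']
    push_cast
    linear_combination (s : ℝ) * s' * h0

/-- For `z = r + sg`, the trace `t = 2r` and norm `n` are integers, and `d(2s)² = t² - 4n` makes
`2s` integral since `d` is squarefree. No case split on `d mod 4` is needed. -/
theorem isQuadraticIntegerRing_of_algHom {K : Type*} [Field K] [NumberField K] {d : ℕ}
    (hsq : Squarefree d) {g : K} (hg : g ^ 2 = d) {δ : 𝓞 K} (hδ : algebraMap (𝓞 K) K δ = g)
    (τ : K →ₐ[ℚ] K) (hτ : τ g = -g)
    (hK : ∀ z : K, ∃ r s : ℚ, z = algebraMap ℚ K r + algebraMap ℚ K s * g) :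
    IsQuadraticIntegerRing d (RingOfIntegers.mapRingHom τ : 𝓞 K →+* 𝓞 K) δ := by
  set σ : 𝓞 K →+* 𝓞 K := RingOfIntegers.mapRingHom τ
  have hσ : ∀ z, algebraMap (𝓞 K) K (σ z) = τ (algebraMap (𝓞 K) K z) := fun z => rfl
  have inj : ∀ x y : 𝓞 K, algebraMap (𝓞 K) K x = algebraMap (𝓞 K) K y → x = y :=
    fun x y h => RingOfIntegers.ext h
  have rat_int : ∀ (z : 𝓞 K) (r : ℚ), algebraMap (𝓞 K) K z = algebraMap ℚ K r →
      ∃ n : ℤ, r = n ∧ z = n := by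
    intro z r h
    have h1 : IsIntegral ℤ r := by
      rw [← isIntegral_algebraMap_iff (B := K) (algebraMap ℚ K).injective, ← h]
      exact z.2
    obtain ⟨n, hn⟩ := IsIntegrallyClosed.isIntegral_iff.1 h1
    refine ⟨n, hn.symm, inj _ _ ?_⟩
    rw [h, ← hn]
    simp
  refine ⟨inj _ _ ?_, inj _ _ ?_, fun z => ?_⟩
  · rw [map_pow, map_natCast, hδ, hg]
  · rw [hσ, map_neg, hδ, hτ]
  · obtain ⟨r, s, hz⟩ := hK (algebraMap (𝓞 K) K z)
    have hτz : τ (algebraMap (𝓞 K) K z) = algebraMap ℚ K r - algebraMap ℚ K s * g := by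
      rw [hz, map_add, map_mul, τ.commutes, τ.commutes, hτ]
      ring
    obtain ⟨t, ht, ht'⟩ := rat_int (z + σ z) (2 * r) (by
      rw [map_add, hσ, hτz, hz, map_mul, map_ofNat]
      ring)
    obtain ⟨n, hn, hn'⟩ := rat_int (z * σ z) (r ^ 2 - d * s ^ 2) (by
      rw [map_mul, hσ, hτz, hz, map_sub, map_mul, map_pow, map_pow, map_natCast]
      linear_combination (-(algebraMap ℚ K s) ^ 2) * hg)
    obtain ⟨y, hy⟩ := exists_intCast_eq_of_mul_sq hsq (y := 2 * s) (k := t ^ 2 - 4 * n) (by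
      push_cast
      rw [← ht, ← hn]
      ring)
    refine ⟨t, y, n, ht', hn', inj _ _ ?_⟩
    have h1 : (t : K) = 2 * algebraMap ℚ K r := by
      rw [← map_intCast (algebraMap ℚ K), ← ht, map_mul, map_ofNat]
    have h2 : (y : K) = 2 * algebraMap ℚ K s := by
      rw [← map_intCast (algebraMap ℚ K), ← hy, map_mul, map_ofNat]
    rw [map_add, map_mul, map_mul, map_ofNat, map_intCast, map_intCast, h1, h2, hz,
      hδ]
    ring

theorem RealQuadraticField.exists_isQuadraticIntegerRing {d : ℕ} (hd : ¬IsSquare d)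
    (hsq : Squarefree d) :
    ∃ (σ : 𝓞 (RealQuadraticField d) →+* 𝓞 (RealQuadraticField d)) (δ : 𝓞 (RealQuadraticField d)),
      IsQuadraticIntegerRing d σ δ := by
  let g : RealQuadraticField d := IntermediateField.AdjoinSimple.gen ℚ √(d : ℝ)
  have hgR : (g : ℝ) = √(d : ℝ) := rfl
  have hg : g ^ 2 = d := by
    apply Subtype.ext
    push_cast
    rw [hgR, Real.sq_sqrt (Nat.cast_nonneg d)]
  have hmin : minpoly ℚ √(d : ℝ) = Polynomial.X ^ 2 - Polynomial.C (d : ℚ) := by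
    refine (minpoly.eq_of_irreducible_of_monic ?_ ?_ ?_).symm
    · refine X_pow_sub_C_irreducible_of_prime Nat.prime_two fun b hb => ?_
      exact hd (Rat.isSquare_natCast_iff.1 ⟨b, by rw [← hb]; ring⟩)
    · simp [Real.sq_sqrt (Nat.cast_nonneg d)]
    · exact Polynomial.monic_X_pow_sub_C _ two_ne_zero
  let τ : RealQuadraticField d →ₐ[ℚ] RealQuadraticField d :=
    (IntermediateField.algHomAdjoinIntegralEquiv ℚ (isIntegral_sqrt_natCast d)).symm ⟨-g, by
      rw [Polynomial.mem_aroots, hmin]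
      refine ⟨(Polynomial.monic_X_pow_sub_C _ two_ne_zero).ne_zero, ?_⟩
      simp [hg]⟩
  have hτ : τ g = -g := IntermediateField.algHomAdjoinIntegralEquiv_symm_apply_gen ..
  have hgi : IsIntegral ℤ g := by
    refine IsIntegral.of_pow two_pos ?_
    rw [hg]
    exact isIntegral_natCast d
  obtain ⟨δ, hδ⟩ : ∃ δ : 𝓞 (RealQuadraticField d), algebraMap _ (RealQuadraticField d) δ = g :=
    ⟨⟨g, hgi⟩, rfl⟩
  refine ⟨_, δ, isQuadraticIntegerRing_of_algHom hsq hg hδ τ hτ fun z => ?_⟩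
  obtain ⟨r, s, hrs⟩ := exists_rat_add_mul_sqrt z
  exact ⟨r, s, Subtype.ext hrs⟩

theorem mainTheorem6 (p m : ℕ) (hp : p.Prime) (hp4 : p ≡ 1 [MOD 4])
    (hhp : realQuadraticClassNumber p = 1)
    (hm : 1 < m) (hmsq : Squarefree m) (hpm : ¬ p ∣ m) :
    2 ≤ realQuadraticClassNumber (m * p) := by
  have hcop : m.Coprime p := ((Nat.Prime.coprime_iff_not_dvd hp).2 hpm).symm
  have hsq : Squarefree (m * p) := (Nat.squarefree_mul hcop).2 ⟨hmsq, hp.squarefree⟩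
  have hd : ¬IsSquare (m * p) := by rw [mul_comm]; exact hp.not_isSquare_mul hpm
  obtain ⟨σ, δ, H⟩ := RealQuadraticField.exists_isQuadraticIntegerRing hd hsq
  have h1 : realQuadraticClassNumber (m * p) ≠ 1 := fun h =>
    not_isPrincipalIdealRing_of_prime_mul H hp hp4 hm hmsq hpm (classNumber_eq_one_iff.1 h)
  have h0 : realQuadraticClassNumber (m * p) ≠ 0 :=
    Fintype.card_ne_zero (α := ClassGroup (𝓞 (RealQuadraticField (m * p))))
  omega
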